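/- **Catching a fast robber.** Let $[n]^2$ denote the graph on $\{1,\dots,n\}^2$ in which two distinct vertices are adjacent if each of their coordinates differs by at most $1$ (the $\ell_\infty$ grid). A game is played on $[n]^2$ by $k$ cops and a robber of speed $2$, with perfect information. First the cops choose their starting vertices (several cops may share a vertex); then the robber chooses his starting vertex. After that the sides move alternately, the cops first: on the cops' turn each cop stays put or moves to an adjacent vertex; on the robber's turn he runs along a path of at most $2$ edges (possibly none). The robber loses if at any point, including in the middle of one of his own turns, he is on the same vertex as a cop. He *can evade $k$ cops* if he has a strategy, which may depend on the whole history of the game, such that, however the cops start and move, he is never on the same vertex as a cop. **Corollary 4.2.** There is an $N$ such that for all integers $n\ge N$ and all integers $0\le k\le n^{0.03}$, a robber of speed $2$ can evade $k$ cops on $[n]^2$. In particular $n^{0.03}$ cops do not suffice to catch him, and the number of cops needed is $\Omega(n^{0.03})$. -/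

import Mathlib

/-- The grid `[n]²` with the `ℓ^∞` metric: two distinct vertices are adjacent exactly when
each of their coordinates differs by at most one. -/
def kingGrid (n : ℕ) : SimpleGraph (Fin n × Fin n) where
  Adj u v := u ≠ v ∧ |((u.1 : ℕ) : ℤ) - ((v.1 : ℕ) : ℤ)| ≤ 1 ∧
    |((u.2 : ℕ) : ℤ) - ((v.2 : ℕ) : ℤ)| ≤ 1
  symm := ⟨fun u v h => ⟨h.1.symm, by rw [abs_sub_comm]; exact h.2.1,
    by rw [abs_sub_comm]; exact h.2.2⟩⟩
  loopless := ⟨fun _ h => h.1 rfl⟩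

namespace FastRobber

variable {V : Type*} {k : ℕ}

/-- A turn of the `k` cops: each of them stays put or moves to an adjacent vertex. Several cops
may share a vertex. -/
def CopMove (G : SimpleGraph V) (c c' : Fin k → V) : Prop :=
  ∀ i, c' i = c i ∨ G.Adj (c i) (c' i)

/-- Some cop is on the vertex `r`. -/
def Occupied (c : Fin k → V) (r : V) : Prop :=
  ∃ i, c i = r

/-- A turn of a robber of speed `s` against cops placed at `c`: he runs from `r` to `r'` along at
most `s` edges (possibly none), without ever being on a vertex occupied by a cop. -/
def RobberMove (G : SimpleGraph V) (s : ℕ) (c : Fin k → V) (r r' : V) : Prop :=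
  ∃ p : G.Walk r r', p.length ≤ s ∧ ∀ v ∈ p.support, ¬ Occupied c v

/-- A strategy of the robber: it reads the list of all cop configurations so far, oldest first,
and says where the robber goes next. On a one-element list, the starting configuration of the
cops, it says where he starts. His own earlier positions are determined by earlier cop
configurations, so he has full information. -/
abbrev RobberStrategy (V : Type*) (k : ℕ) : Type _ :=
  List (Fin k → V) → V

/-- The position of the robber after his `t`-th turn (his choice of a start is turn `0`) when he
follows `σ` and `c 0, c 1, c 2, …` are the successive configurations of the cops. It depends only
on `c 0, …, c t`. -/
def RobberStrategy.position (σ : RobberStrategy V k) (c : ℕ → Fin k → V) (t : ℕ) : V :=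
  σ ((List.range (t + 1)).map c)

/-- In the game of catching a robber of speed `s` on `G`, the robber can evade `k` cops for ever.
The order of play is: the cops choose `c 0`, the robber chooses his starting vertex, and then, for
`t = 0, 1, 2, …`, the cops move from `c t` to `c (t + 1)` and the robber replies. The robber has a
strategy by which, however the cops play, all his moves are legal and no cop is ever on his
vertex. -/
def RobberEvades (G : SimpleGraph V) (s k : ℕ) : Prop :=
  ∃ σ : RobberStrategy V k, ∀ c : ℕ → Fin k → V,
    (∀ t, CopMove G (c t) (c (t + 1))) →
      ¬ Occupied (c 0) (σ.position c 0) ∧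
      ∀ t, ¬ Occupied (c (t + 1)) (σ.position c t) ∧
        RobberMove G s (c (t + 1)) (σ.position c t) (σ.position c (t + 1))

end FastRobber

/-! The robber always runs diagonally at full speed, so he gains at least one unit per turn on any
cop in a coordinate in which he runs away from that cop. He maintains, for every level `i ≤ J`, that
fewer than `2 ^ i` cops are within `reach i`. Level `J` is free because `k < 2 ^ J`; level `0` says
that no cop is within distance 4. To descend from level `i + 1` to level `i` (`block_step`): if `2 ^
i` cops are around at the start of a block, then above or below the robber there are fewer than `2 ^
i` of the fewer than `2 ^ (i + 1)` cops in the larger square. He runs to that side, and the other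
cops fall behind.

Lower levels have priority, so they must seldom override higher ones. Since the horizontal direction
is frozen while a level below `J` is active, each cop drifts past the robber horizontally and is
near him at boundedly many block starts of level `j`. Activating level `j` takes `2 ^ j` cops, so
double counting (`card_starts_le`) and the rapid growth of the scales limit the overriding to 1% of
each block (`card_interference_le`). The same bound at level `J`, whose demand is to head for the
middle in both coordinates, keeps him on the board (`mem_board`). -/

namespace FastRobber

/-! ### Scales of length and time -/

/-- The radius within which fewer than `2 ^ i` cops are ever tolerated at level `i`. -/
def reach (i : ℕ) : ℕ := 4 * 65536 ^ i

/-- The length of the time blocks of level `i`. -/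
def period (i : ℕ) : ℕ := 16 * reach i

theorem reach_succ (i : ℕ) : reach (i + 1) = 65536 * reach i := by
  unfold reach; ring

theorem reach_pos (i : ℕ) : 0 < reach i := by
  unfold reach; positivity

theorem four_le_reach (i : ℕ) : 4 ≤ reach i :=
  Nat.le_mul_of_pos_right _ (by positivity)

theorem period_pos (i : ℕ) : 0 < period i :=
  Nat.mul_pos (by norm_num) (reach_pos i)

theorem reach_mono {i j : ℕ} (h : i ≤ j) : reach i ≤ reach j :=
  Nat.mul_le_mul_left _ (Nat.pow_le_pow_right (by norm_num) h)

theorem period_dvd {i j : ℕ} (h : i ≤ j) : period i ∣ period j :=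
  Nat.mul_dvd_mul_left _ (Nat.mul_dvd_mul_left _ (Nat.pow_dvd_pow _ h))

/-- The constant 3600 is 36, from counting the activations of level `j`, times 100, for the 1%
bound. The ratio 65536 of consecutive scales leaves ample room. -/
theorem sum_period_le (i : ℕ) :
    3600 * ∑ j ∈ Finset.range i, period j * 2 ^ (i - j) ≤ period i := by
  induction i with
  | zero => simp
  | succ i ih =>
    have h : ∑ j ∈ Finset.range i, period j * 2 ^ (i + 1 - j)
        = 2 * ∑ j ∈ Finset.range i, period j * 2 ^ (i - j) := by
      rw [Finset.mul_sum]
      refine Finset.sum_congr rfl fun j hj => ?_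
      rw [Nat.succ_sub (Finset.mem_range.1 hj).le, pow_succ]; ring
    rw [Finset.sum_range_succ, h, Nat.add_sub_cancel_left]
    have := reach_succ i
    simp only [period] at *
    omega

/-! ### The robber's rules and his runs -/

/-- The cops, with coordinates `u` and `v`, at distance at most `ρ` from `(x, y)`. -/
def near {k : ℕ} (x y : ℤ) (u v : Fin k → ℤ) (ρ : ℕ) : Finset (Fin k) :=
  {c | |u c - x| ≤ ρ ∧ |v c - y| ≤ ρ}

/-- The vertical direction in which level `i` wants to run from `(x, y)`: none if fewer than `2 ^ i`
cops are around, and otherwise the side on which fewer than `2 ^ i` cops are waiting. -/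
def evasion {k : ℕ} (i : ℕ) (x y : ℤ) (u v : Fin k → ℤ) : ℤ :=
  if (near x y u v (64 * reach i)).card < 2 ^ i then 0
  else if ((near x y u v (reach (i + 1))).filter fun c => y < v c).card < 2 ^ i then 1
  else -1

/-- The direction from `x` towards the middle of `0, …, n - 1`. -/
def inward (n : ℕ) (x : ℤ) : ℤ := if 2 * x < n then 1 else -1

/-- A run of a robber who at time `t` is at `(x t, y t)` and then moves by `(2 * dx t, 2 * dy t)`,
while cop `c` is at `(u t c, v t c)`; `e t i` is the direction which level `i < J` currently
demands (`0` for none). Undisturbed, the robber moves horizontally in the direction `f t` and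
vertically in the direction `e t J`. -/
structure Run (k J n : ℕ) where
  u : ℕ → Fin k → ℤ
  v : ℕ → Fin k → ℤ
  x : ℕ → ℤ
  y : ℕ → ℤ
  dx : ℕ → ℤ
  dy : ℕ → ℤ
  e : ℕ → ℕ → ℤ
  f : ℕ → ℤ
  card_lt : k < 2 ^ J
  abs_u : ∀ t c, |u (t + 1) c - u t c| ≤ 1
  abs_v : ∀ t c, |v (t + 1) c - v t c| ≤ 1
  x_succ : ∀ t, x (t + 1) = x t + 2 * dx t
  y_succ : ∀ t, y (t + 1) = y t + 2 * dy t
  dx_cases : ∀ t, dx t = 1 ∨ dx t = -1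
  e_start : ∀ t i, i < J → period i ∣ t → e t i = evasion i (x t) (y t) (u t) (v t)
  e_top : ∀ t, period J ∣ t → e t J = inward n (y t)
  f_top : ∀ t, period J ∣ t → f t = inward n (x t)
  e_succ : ∀ t i, ¬ period i ∣ t + 1 → e (t + 1) i = e t i
  f_succ : ∀ t, ¬ period J ∣ t + 1 → f (t + 1) = f t
  dy_eq : ∀ t i, i ≤ J → e t i ≠ 0 → (∀ j < i, e t j = 0) → dy t = e t i
  dx_succ : ∀ t i, i < J → e (t + 1) i ≠ 0 → dx (t + 1) = dx t
  dx_eq : ∀ t, (∀ i < J, e t i = 0) → dx t = f t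

theorem inward_cases (n : ℕ) (x : ℤ) : inward n x = 1 ∨ inward n x = -1 := by
  unfold inward; split_ifs <;> simp

theorem evasion_cases {k : ℕ} (i : ℕ) (x y : ℤ) (u v : Fin k → ℤ) :
    evasion i x y u v = 0 ∨ evasion i x y u v = 1 ∨ evasion i x y u v = -1 := by
  unfold evasion; split_ifs <;> simp

theorem block_const {α : Type*} {g : ℕ → α} {L : ℕ} (h : ∀ t, ¬ L ∣ t + 1 → g (t + 1) = g t)
    {t : ℕ} (ht : L ∣ t) {s : ℕ} (hs : s < L) : g (t + s) = g t := by
  induction s with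
  | zero => rfl
  | succ s ih =>
    rw [← add_assoc, h _ _, ih (by omega)]
    rw [add_assoc, Nat.dvd_add_right ht]
    exact Nat.not_dvd_of_pos_of_lt (by omega) hs

/-- A walk with steps `±2` that makes the step `2 * d` except at `m` times. -/
theorem displacement {z g : ℕ → ℤ} {d : ℤ} (hz : ∀ t, z (t + 1) = z t + 2 * g t)
    (hg : ∀ t, g t = 1 ∨ g t = -1) (hd : d = 1 ∨ d = -1) (t s : ℕ) :
    d * (z (t + s) - z t) ≤ 2 * s ∧
    2 * s - 4 * (((Finset.Ico t (t + s)).filter fun r => g r ≠ d).card : ℤ)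
      ≤ d * (z (t + s) - z t) := by
  induction s with
  | zero => simp
  | succ s ih =>
    rw [← add_assoc, hz, ← Finset.insert_Ico_right_eq_Ico_add_one (by omega),
      Finset.filter_insert]
    by_cases h : g (t + s) = d
    · rw [if_neg (by simpa using h), h]
      push_cast
      rcases hd with rfl | rfl <;> constructor <;> linarith [ih.1, ih.2]
    · rw [if_pos h, Finset.card_insert_of_notMem (by simp)]
      push_cast
      have h' : d * g (t + s) = -1 := by
        rcases hd with rfl | rfl <;> rcases hg (t + s) with h1 | h1 <;> simp_all
      constructor <;> linarith [ih.1, ih.2]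

namespace Run

variable {k J n : ℕ} (R : Run k J n)

/-- The cops at distance at most `ρ` from the robber at time `t`. -/
def close (t ρ : ℕ) : Finset (Fin k) := near (R.x t) (R.y t) (R.u t) (R.v t) ρ

theorem mem_close {t ρ : ℕ} {c : Fin k} :
    c ∈ R.close t ρ ↔ |R.u t c - R.x t| ≤ ρ ∧ |R.v t c - R.y t| ≤ ρ := by
  simp [close, near]

theorem close_mono (t : ℕ) {ρ ρ' : ℕ} (h : ρ ≤ ρ') : R.close t ρ ⊆ R.close t ρ' := by
  intro c hc
  rw [mem_close] at *
  have : (ρ : ℤ) ≤ ρ' := by exact_mod_cast h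
  exact ⟨hc.1.trans this, hc.2.trans this⟩

theorem e_eq {i t s : ℕ} (ht : period i ∣ t) (hs : s < period i) :
    R.e (t + s) i = R.e t i :=
  block_const (g := fun t => R.e t i) (fun t => R.e_succ t i) ht hs

theorem f_eq {t s : ℕ} (ht : period J ∣ t) (hs : s < period J) : R.f (t + s) = R.f t :=
  block_const R.f_succ ht hs

theorem e_cases {i : ℕ} (hi : i < J) (t : ℕ) :
    R.e t i = 0 ∨ R.e t i = 1 ∨ R.e t i = -1 := by
  have h := R.e_eq (Nat.dvd_mul_left (period i) (t / period i)) (Nat.mod_lt t (period_pos i))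
  rw [mul_comm, Nat.div_add_mod] at h
  rw [h, R.e_start _ i hi (Nat.dvd_mul_right _ _)]
  exact evasion_cases _ _ _ _ _

theorem e_top_cases (t : ℕ) : R.e t J = 1 ∨ R.e t J = -1 := by
  have h := R.e_eq (Nat.dvd_mul_left (period J) (t / period J)) (Nat.mod_lt t (period_pos J))
  rw [mul_comm, Nat.div_add_mod] at h
  rw [h, R.e_top _ (Nat.dvd_mul_right _ _)]
  exact inward_cases _ _

theorem e_cases_of_ne {i : ℕ} (hi : i ≤ J) {t : ℕ} (h : R.e t i ≠ 0) :
    R.e t i = 1 ∨ R.e t i = -1 := by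
  rcases hi.lt_or_eq with hi | rfl
  · exact (R.e_cases hi t).resolve_left h
  · exact R.e_top_cases t

theorem dy_eq_or {i : ℕ} (hi : i ≤ J) {t : ℕ} (h : R.e t i ≠ 0) :
    R.dy t = R.e t i ∨ ∃ j < i, R.e t j ≠ 0 := by
  by_cases h' : ∃ j < i, R.e t j ≠ 0
  · exact .inr h'
  · push Not at h'
    exact .inl (R.dy_eq t i hi h h')

theorem dy_cases (t : ℕ) : R.dy t = 1 ∨ R.dy t = -1 := by
  classical
  have hJ : ∃ i, i ≤ J ∧ R.e t i ≠ 0 :=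
    ⟨J, le_rfl, by rcases R.e_top_cases t with h | h <;> simp [h]⟩
  have h := Nat.find_spec hJ
  rw [R.dy_eq t _ h.1 h.2 fun j hj => by
    by_contra hne
    exact Nat.find_min hJ hj ⟨hj.le.trans h.1, hne⟩]
  exact R.e_cases_of_ne h.1 h.2

theorem abs_offset_succ (t : ℕ) (c : Fin k) :
    |(R.u (t + 1) c - R.x (t + 1)) - (R.u t c - R.x t)| ≤ 3 ∧
    |(R.v (t + 1) c - R.y (t + 1)) - (R.v t c - R.y t)| ≤ 3 := by
  have h1 := abs_le.1 (R.abs_u t c)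
  have h2 := abs_le.1 (R.abs_v t c)
  rw [R.x_succ, R.y_succ, abs_le, abs_le]
  rcases R.dx_cases t with h | h <;> rcases R.dy_cases t with h' | h' <;> rw [h, h'] <;> omega

theorem abs_offset (t s : ℕ) (c : Fin k) :
    |(R.u (t + s) c - R.x (t + s)) - (R.u t c - R.x t)| ≤ 3 * s ∧
    |(R.v (t + s) c - R.y (t + s)) - (R.v t c - R.y t)| ≤ 3 * s := by
  induction s with
  | zero => simp
  | succ s ih =>
    have h := R.abs_offset_succ (t + s) c
    simp only [abs_le, ← add_assoc] at *
    push_cast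
    omega

theorem close_add_subset (t s ρ : ℕ) : R.close (t + s) ρ ⊆ R.close t (ρ + 3 * s) := by
  intro c hc
  have h := R.abs_offset t s c
  rw [mem_close] at *
  simp only [abs_le] at *
  push_cast
  omega

theorem abs_v_add (t s : ℕ) (c : Fin k) : |R.v (t + s) c - R.v t c| ≤ s := by
  induction s with
  | zero => simp
  | succ s ih =>
    have h := R.abs_v (t + s) c
    simp only [abs_le, ← add_assoc] at *
    push_cast
    omega

/-- The robber advances by 2 and a cop by at most 1, so every cop, wherever it stands, drifts
backwards relative to him. -/
theorem offset_anti {d : ℤ} (hd : d = 1 ∨ d = -1) {t s : ℕ}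
    (h : ∀ r, t ≤ r → r < t + s → R.dx r = d) (c : Fin k) :
    d * ((R.u (t + s) c - R.x (t + s)) - (R.u t c - R.x t)) ≤ -s := by
  induction s with
  | zero => simp
  | succ s ih =>
    have h1 := ih fun r h1 h2 => h r h1 (by omega)
    have h2 := abs_le.1 (R.abs_u (t + s) c)
    rw [← add_assoc, R.x_succ, h (t + s) (by omega) (by omega)]
    push_cast
    rcases hd with rfl | rfl <;> linarith [h2.1, h2.2]

/-! ### Interference of the lower levels -/

/-- While the robber keeps his horizontal direction, each cop is close to him for a short time. -/
theorem card_starts_close_le {d : ℤ} (hd : d = 1 ∨ d = -1) {t t' L : ℕ} (hL : 0 < L)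
    (h : ∀ r, t ≤ r → r < t' → R.dx r = d) (c : Fin k) :
    ((Finset.Ico t t').filter fun r => L ∣ r ∧ c ∈ R.close r (4 * L)).card ≤ 9 := by
  classical
  set A := (Finset.Ico t t').filter fun r => L ∣ r ∧ c ∈ R.close r (4 * L) with hA
  rcases A.eq_empty_or_nonempty with h0 | h0
  · simp [h0]
  have hm := A.min'_mem h0
  set a := A.min' h0
  -- The horizontal offset falls by at least 1 per turn and stays in a window of width `8 * L`, so
  -- the multiples of `L` in question lie within `8 * L` of the first.
  have hsub : A ⊆ (Finset.range 9).image fun j => a + L * j := by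
    intro r hr
    have har : a ≤ r := A.min'_le r hr
    obtain ⟨s, rfl⟩ := Nat.exists_eq_add_of_le har
    rw [hA, Finset.mem_filter, Finset.mem_Ico, mem_close] at hr hm
    have h1 := R.offset_anti hd (t := a) (s := s)
      (fun r' h1 h2 => h r' (by omega) (by omega)) c
    obtain ⟨j, rfl⟩ := (Nat.dvd_add_right hm.2.1).1 hr.2.1
    have h2 := abs_le.1 hr.2.2.1
    have h3 := abs_le.1 hm.2.2.1
    have h4 : ((L * j : ℕ) : ℤ) ≤ 8 * L := by
      push_cast at *
      rcases hd with rfl | rfl <;> linarith [h2.1, h2.2, h3.1, h3.2]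
    have h5 : j ≤ 8 := by
      have : L * j ≤ L * 8 := by rw [mul_comm L 8]; exact_mod_cast h4
      exact Nat.le_of_mul_le_mul_left this hL
    exact Finset.mem_image.2 ⟨j, Finset.mem_range.2 (by omega), rfl⟩
  exact (Finset.card_le_card hsub).trans (Finset.card_image_le.trans (by simp))

/-- The times from `t` to `t' - 1` at which level `j` is active. -/
def active (j t t' : ℕ) : Finset ℕ := (Finset.Ico t t').filter fun r => R.e r j ≠ 0

/-- The block starts of level `j` from `t` to `t' - 1` at which this level becomes active. -/
def starts (j t t' : ℕ) : Finset ℕ := (R.active j t t').filter fun r => period j ∣ r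

/-- Each active time is charged to the start of its block; as `t` is itself a block start, no charge
falls before `t`. -/
theorem card_active_le {j t L : ℕ} (ht : period j ∣ t) :
    (R.active j t (t + L)).card ≤ period j * (R.starts j t (t + L)).card := by
  classical
  refine Finset.card_le_mul_card_image_of_maps_to (f := fun r => period j * (r / period j)) ?_ _ ?_
  · intro r hr
    simp only [starts, active, Finset.mem_filter, Finset.mem_Ico] at *
    have h := R.e_eq (Nat.dvd_mul_right (period j) (r / period j)) (Nat.mod_lt r (period_pos j))
    rw [Nat.div_add_mod] at h
    refine ⟨⟨⟨?_, ?_⟩, h ▸ hr.2⟩, Nat.dvd_mul_right _ _⟩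
    · obtain ⟨q, rfl⟩ := ht
      exact Nat.mul_le_mul_left _ ((Nat.le_div_iff_mul_le (period_pos j)).2
        (by rw [mul_comm]; exact hr.1.1))
    · exact (Nat.mul_div_le _ _).trans_lt hr.1.2
  · intro b _
    refine (Finset.card_le_card (t := Finset.Ico b (b + period j)) ?_).trans (by simp)
    intro r hr
    rw [Finset.mem_filter] at hr
    rw [Finset.mem_Ico, ← hr.2]
    have := Nat.div_add_mod r (period j)
    have := Nat.mod_lt r (period_pos j)
    omega

/-- Double counting of pairs (activation, nearby cop): an activation involves at least `2 ^ j` cops,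
and a cop occurs at most 9 times for each of the two horizontal directions. -/
theorem card_starts_le {j t L w : ℕ} (hj : j < J) {d d' : ℤ}
    (hd : d = 1 ∨ d = -1) (hd' : d' = 1 ∨ d' = -1)
    (h : ∀ r, t ≤ r → r < w → R.dx r = d) (h' : ∀ r, w ≤ r → r < t + L → R.dx r = d')
    (K : Finset (Fin k))
    (hK : ∀ r, t ≤ r → r < t + L → R.close r (4 * period j) ⊆ K) :
    (R.starts j t (t + L)).card * 2 ^ j ≤ 18 * K.card := by
  classical
  have h1 : ∀ r ∈ R.starts j t (t + L),
      2 ^ j ≤ (K.filter fun c => c ∈ R.close r (4 * period j)).card := by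
    intro r hr
    simp only [starts, active, Finset.mem_filter, Finset.mem_Ico] at hr
    have he := hr.1.2
    rw [R.e_start r j hj hr.2, evasion] at he
    have h2 : 2 ^ j ≤ (R.close r (4 * period j)).card := by
      by_contra hlt
      rw [if_pos] at he
      · exact he rfl
      · have : 64 * reach j = 4 * period j := by unfold period; ring
        rw [this]
        exact not_le.1 hlt
    refine h2.trans (Finset.card_le_card fun c hc => ?_)
    exact Finset.mem_filter.2 ⟨hK r hr.1.1.1 hr.1.1.2 hc, hc⟩
  have h2 : ∀ c ∈ K, ((R.starts j t (t + L)).filter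
      fun r => c ∈ R.close r (4 * period j)).card ≤ 18 := by
    intro c _
    have hsub : (R.starts j t (t + L)).filter (fun r => c ∈ R.close r (4 * period j)) ⊆
        ((Finset.Ico t w).filter fun r => period j ∣ r ∧ c ∈ R.close r (4 * period j)) ∪
        ((Finset.Ico w (t + L)).filter
          fun r => period j ∣ r ∧ c ∈ R.close r (4 * period j)) := by
      intro r hr
      simp only [starts, active, Finset.mem_filter, Finset.mem_Ico, Finset.mem_union] at *
      rcases lt_or_ge r w with hw | hw
      · exact .inl ⟨⟨hr.1.1.1.1, hw⟩, hr.1.2, hr.2⟩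
      · exact .inr ⟨⟨hw, hr.1.1.1.2⟩, hr.1.2, hr.2⟩
    refine (Finset.card_le_card hsub).trans ((Finset.card_union_le _ _).trans ?_)
    have e1 := R.card_starts_close_le hd (period_pos j) h c
    have e2 := R.card_starts_close_le hd' (period_pos j) h' c
    omega
  have h3 := Finset.card_nsmul_le_sum _ _ _ h1
  have h4 := Finset.sum_le_card_nsmul _ _ _ h2
  have h5 := Finset.sum_card_bipartiteAbove_eq_sum_card_bipartiteBelow
    (s := R.starts j t (t + L)) (t := K) (fun r c => c ∈ R.close r (4 * period j))
  simp only [Finset.bipartiteAbove, Finset.bipartiteBelow] at h5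
  rw [h5] at h3
  simp only [smul_eq_mul] at h3 h4
  linarith

/-- In a block of level `i` the lower levels interfere at few times only. -/
theorem card_interference_le {i t w : ℕ} (hi : i ≤ J) (ht : period i ∣ t) {d d' : ℤ}
    (hd : d = 1 ∨ d = -1) (hd' : d' = 1 ∨ d' = -1)
    (h : ∀ r, t ≤ r → r < w → R.dx r = d)
    (h' : ∀ r, w ≤ r → r < t + period i → R.dx r = d')
    (K : Finset (Fin k)) (hcard : K.card ≤ 2 ^ (i + 1))
    (hK : ∀ j < i, ∀ r, t ≤ r → r < t + period i → R.close r (4 * period j) ⊆ K) :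
    100 * ((Finset.Ico t (t + period i)).filter fun r => ∃ j < i, R.e r j ≠ 0).card
      ≤ period i := by
  classical
  have hsub : ((Finset.Ico t (t + period i)).filter fun r => ∃ j < i, R.e r j ≠ 0) ⊆
      (Finset.range i).biUnion fun j => R.active j t (t + period i) := by
    intro r hr
    simp only [active, Finset.mem_filter, Finset.mem_biUnion, Finset.mem_range] at *
    obtain ⟨hr, j, hj, hne⟩ := hr
    exact ⟨j, hj, hr, hne⟩
  have hj : ∀ j ∈ Finset.range i, (R.active j t (t + period i)).card ≤
      36 * (period j * 2 ^ (i - j)) := by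
    intro j hj
    rw [Finset.mem_range] at hj
    have h1 := R.card_active_le (L := period i) ((period_dvd hj.le).trans ht)
    have h2 := R.card_starts_le (hj.trans_le hi) hd hd' h h' K (hK j hj)
    have h3 : (R.starts j t (t + period i)).card ≤ 36 * 2 ^ (i - j) := by
      refine Nat.le_of_mul_le_mul_right (c := 2 ^ j) ?_ (Nat.two_pow_pos j)
      have h4 : 36 * 2 ^ (i - j) * 2 ^ j = 18 * 2 ^ (i + 1) := by
        rw [mul_assoc, ← pow_add, Nat.sub_add_cancel hj.le, pow_succ]; ring
      rw [h4]
      exact h2.trans (Nat.mul_le_mul_left _ hcard)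
    calc _ ≤ period j * (R.starts j t (t + period i)).card := h1
      _ ≤ period j * (36 * 2 ^ (i - j)) := Nat.mul_le_mul_left _ h3
      _ = _ := by ring
  have h1 := (Finset.card_le_card hsub).trans
    (Finset.card_biUnion_le.trans (Finset.sum_le_sum hj))
  rw [← Finset.mul_sum] at h1
  have h2 := sum_period_le i
  omega

/-! ### Descent from level `i + 1` to level `i` -/

theorem dx_const_of_active {i t : ℕ} (hi : i < J) (ht : period i ∣ t) (he : R.e t i ≠ 0) :
    ∀ r, t ≤ r → r < t + period i → R.dx r = R.dx t := by
  intro r h1 h2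
  obtain ⟨s, rfl⟩ := Nat.exists_eq_add_of_le h1
  clear h1
  induction s with
  | zero => rfl
  | succ s ih =>
    rw [← add_assoc, R.dx_succ (t + s) i hi _, ih (by omega)]
    rw [add_assoc, R.e_eq ht (by omega)]
    exact he

/-- In an active block of level `i`, the cops on the side which is avoided fall behind. -/
theorem avoided_far {i t : ℕ} (hi : i < J) (ht : period i ∣ t) (he : R.e t i ≠ 0)
    (hG : (R.close t (reach (i + 1))).card < 2 ^ (i + 1)) {s : ℕ} (hs : s ≤ period i)
    {c : Fin k} (hc : R.e t i * (R.v t c - R.y t) ≤ 0) :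
    25 * (s : ℤ) - period i ≤ 25 * |R.v (t + s) c - R.y (t + s)| := by
  classical
  have hd := R.e_cases_of_ne hi.le he
  have hdx := R.dx_const_of_active hi ht he
  -- The horizontal direction never changes here, so the phase before `w = t` is empty.
  have hint := R.card_interference_le hi.le ht (w := t) (d := 1) (.inl rfl) (R.dx_cases t)
    (fun r h1 h2 => by omega) hdx (R.close t (reach (i + 1))) hG.le (by
      intro j hj r h1 h2
      obtain ⟨s, rfl⟩ := Nat.exists_eq_add_of_le h1
      refine (R.close_add_subset t s _).trans (R.close_mono t ?_)
      have := reach_mono hj.le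
      have := reach_succ i
      unfold period at *
      omega)
  have hbad : ((Finset.Ico t (t + s)).filter fun r => R.dy r ≠ R.e t i).card ≤
      ((Finset.Ico t (t + period i)).filter fun r => ∃ j < i, R.e r j ≠ 0).card := by
    refine Finset.card_le_card fun r hr => ?_
    simp only [Finset.mem_filter, Finset.mem_Ico] at *
    refine ⟨⟨hr.1.1, by omega⟩, ?_⟩
    obtain ⟨s', rfl⟩ := Nat.exists_eq_add_of_le hr.1.1
    have he' := R.e_eq ht (s := s') (by omega)
    refine (R.dy_eq_or hi.le (he' ▸ he)).resolve_left fun h => hr.2 ?_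
    rw [h, he']
  have hdisp := (displacement R.y_succ R.dy_cases hd t s).2
  have hv := abs_le.1 (R.abs_v_add t s c)
  have hle : |R.e t i * (R.v (t + s) c - R.y (t + s))| = |R.v (t + s) c - R.y (t + s)| := by
    rcases hd with h | h <;> rw [h] <;> simp
    rw [abs_sub_comm]
  have hneg := neg_le_abs (R.e t i * (R.v (t + s) c - R.y (t + s)))
  rw [hle] at hneg
  have hint' : (100 : ℤ) * ((Finset.Ico t (t + s)).filter fun r => R.dy r ≠ R.e t i).card ≤
      period i := by
    exact_mod_cast (Nat.mul_le_mul_left 100 hbad).trans hint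
  generalize ((Finset.Ico t (t + s)).filter fun r => R.dy r ≠ R.e t i).card = m at hdisp hint'
  rcases hd with h | h <;> rw [h] at hdisp hneg hc <;> linarith [hv.1, hv.2]

/-- If at least `2 ^ i` of fewer than `2 ^ (i + 1)` cops are above, fewer than `2 ^ i` are not. -/
theorem card_dangerous_lt {i t : ℕ} (hi : i < J) (ht : period i ∣ t) (he : R.e t i ≠ 0)
    (hG : (R.close t (reach (i + 1))).card < 2 ^ (i + 1)) :
    ((R.close t (reach (i + 1))).filter fun c => 0 < R.e t i * (R.v t c - R.y t)).card < 2 ^ i := by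
  classical
  have hstart := R.e_start t i hi ht
  rw [evasion] at hstart
  split_ifs at hstart with h1 h2
  · exact absurd hstart he
  · refine lt_of_le_of_lt (Finset.card_le_card ?_) h2
    intro c hc
    rw [Finset.mem_filter, hstart] at hc
    exact Finset.mem_filter.2 ⟨hc.1, by linarith [hc.2]⟩
  · have h3 : ((R.close t (reach (i + 1))).filter
        fun c => 0 < R.e t i * (R.v t c - R.y t)).card ≤
        ((R.close t (reach (i + 1))).filter fun c => ¬ R.y t < R.v t c).card := by
      refine Finset.card_le_card fun c hc => ?_
      rw [Finset.mem_filter, hstart] at hc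
      exact Finset.mem_filter.2 ⟨hc.1, by linarith [hc.2]⟩
    have h4 := Finset.card_filter_add_card_filter_not (s := R.close t (reach (i + 1)))
      (fun c => R.y t < R.v t c)
    have h5 : 2 ^ i ≤ ((R.close t (reach (i + 1))).filter fun c => R.y t < R.v t c).card :=
      not_lt.1 h2
    rw [pow_succ] at hG
    omega

/-- One block of level `i`. -/
theorem block_step {i t : ℕ} (hi : i < J) (ht : period i ∣ t)
    (hG : (R.close t (reach (i + 1))).card < 2 ^ (i + 1))
    (hA : (R.close t (8 * reach i)).card < 2 ^ i) :
    (R.close (t + period i) (8 * reach i)).card < 2 ^ i ∧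
    ∀ s < period i, (R.close (t + s) (reach i)).card < 2 ^ i := by
  classical
  have hr := reach_pos i
  have hrs := reach_succ i
  by_cases he : R.e t i = 0
  · have h0 : (R.close t (64 * reach i)).card < 2 ^ i := by
      rw [R.e_start t i hi ht, evasion] at he
      by_contra hne
      rw [if_neg (by exact hne)] at he
      split_ifs at he; simp at he
    -- Offsets change by at most 3 per turn, hence by `48 * reach i` in a block, and 8 + 48 ≤ 64.
    refine ⟨lt_of_le_of_lt (Finset.card_le_card ?_) h0, fun s hs =>
      lt_of_le_of_lt (Finset.card_le_card ?_) h0⟩ <;>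
    · refine (R.close_add_subset t _ _).trans (R.close_mono t ?_)
      unfold period at *
      omega
  · have hdang := R.card_dangerous_lt hi ht he hG
    have key : ∀ s ≤ period i, ∀ ρ : ℕ, 25 * ρ + period i < 25 * s → ρ ≤ 8 * reach i →
        (R.close (t + s) ρ).card < 2 ^ i := by
      intro s hs ρ hρ hρ'
      refine lt_of_le_of_lt (Finset.card_le_card fun c hc => ?_) hdang
      refine Finset.mem_filter.2 ⟨?_, ?_⟩
      · refine R.close_mono t ?_ (R.close_add_subset t s ρ hc)
        unfold period at *
        omega
      · by_contra hneg
        have h1 := R.avoided_far hi ht he hG hs (not_lt.1 hneg)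
        have h2 := (R.mem_close.1 hc).2
        omega
    refine ⟨key _ le_rfl _ ?_ le_rfl, fun s hs => ?_⟩
    · unfold period
      omega
    -- Early on, the buffer `8 * reach i` from the block start suffices (1 + 3 · 2 ≤ 8); later the
    -- avoided cops are already far enough behind.
    · rcases le_or_gt s (2 * reach i) with h | h
      · refine lt_of_le_of_lt (Finset.card_le_card ?_) hA
        refine (R.close_add_subset t s _).trans (R.close_mono t ?_)
        omega
      · refine key s hs.le _ ?_ (by omega)
        unfold period at *
        omega

/-- Downward induction on the level; within a level, induction over its blocks carries the stronger
radius `8 * reach i` from one block start to the next. -/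
theorem card_close_lt (h0 : R.close 0 (8 * reach J) = ∅) {i : ℕ} (hi : i ≤ J) (t : ℕ) :
    (R.close t (reach i)).card < 2 ^ i := by
  induction hi using Nat.decreasingInduction generalizing t with
  | self => exact (Finset.card_le_univ _).trans_lt (by simpa using R.card_lt)
  | of_succ i hi ih =>
    have hA : ∀ q, (R.close (period i * q) (8 * reach i)).card < 2 ^ i := by
      intro q
      induction q with
      | zero =>
        have : R.close 0 (8 * reach i) = ∅ := by
          refine Finset.subset_empty.1 (h0 ▸ R.close_mono 0 ?_)
          exact Nat.mul_le_mul_left _ (reach_mono hi.le)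
        simp [this]
      | succ q ihq =>
        exact (R.block_step hi (Nat.dvd_mul_right _ _) (ih _) ihq).1
    have h := (R.block_step hi (Nat.dvd_mul_right _ (t / period i)) (ih _) (hA _)).2
      _ (Nat.mod_lt t (period_pos i))
    rwa [Nat.div_add_mod] at h

theorem close_four_eq_empty (h0 : R.close 0 (8 * reach J) = ∅) (t : ℕ) : R.close t 4 = ∅ := by
  have h := R.card_close_lt h0 (Nat.zero_le J) t
  simpa [reach] using h

/-! ### Staying on the board -/

/-- In a block of the top level the horizontal direction changes at most once. -/
theorem exists_change {t : ℕ} (ht : period J ∣ t) :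
    ∃ w, (∀ r, t ≤ r → r < w → R.dx r = R.dx t) ∧
      (∀ r, w ≤ r → r < t + period J → R.dx r = R.f t) ∧
      ∀ r, t ≤ r → r < w → ∃ j < J, R.e r j ≠ 0 := by
  classical
  have hconst : ∀ s, (∀ r, t ≤ r → r < t + s → ∃ j < J, R.e r j ≠ 0) →
      ∀ s' < s, R.dx (t + s') = R.dx t := by
    intro s hs s' hs'
    induction s' with
    | zero => rfl
    | succ s' ih =>
      obtain ⟨j, hj, hne⟩ := hs (t + (s' + 1)) (by omega) (by omega)
      rw [← add_assoc] at *
      rw [R.dx_succ _ j hj hne, ih (by omega)]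
  -- The change happens at the first moment when no lower level is active; from then on the
  -- direction is `f`, constant in the block.
  by_cases h : ∃ s, s < period J ∧ ∀ j < J, R.e (t + s) j = 0
  · have hm : ∀ r, t ≤ r → r < t + Nat.find h → ∃ j < J, R.e r j ≠ 0 := by
      intro r h1 h2
      obtain ⟨s, rfl⟩ := Nat.exists_eq_add_of_le h1
      have h3 := Nat.find_min h (m := s) (by omega)
      have h4 := (Nat.find_spec h).1
      by_contra h5
      push Not at h5
      exact h3 ⟨by omega, h5⟩
    refine ⟨t + Nat.find h, fun r h1 h2 => ?_, fun r h1 h2 => ?_, hm⟩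
    · obtain ⟨s, rfl⟩ := Nat.exists_eq_add_of_le h1
      exact hconst _ hm s (by omega)
    · obtain ⟨s, rfl⟩ := Nat.exists_eq_add_of_le h1
      have hz := (Nat.find_spec h).2
      clear hm h1
      induction s with
      | zero =>
        rw [add_zero, R.dx_eq _ hz, R.f_eq ht (Nat.find_spec h).1]
      | succ s ih =>
        by_cases h3 : ∀ j < J, R.e (t + Nat.find h + (s + 1)) j = 0
        · rw [R.dx_eq _ h3, add_assoc, R.f_eq ht (by omega)]
        · push Not at h3
          obtain ⟨j, hj, hne⟩ := h3
          rw [← add_assoc] at *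
          rw [R.dx_succ _ j hj hne, ih (by omega)]
  · push Not at h
    have hm : ∀ r, t ≤ r → r < t + period J → ∃ j < J, R.e r j ≠ 0 := by
      intro r h1 h2
      obtain ⟨s, rfl⟩ := Nat.exists_eq_add_of_le h1
      exact h s (by omega)
    refine ⟨t + period J, fun r h1 h2 => ?_, fun r h1 h2 => by omega, hm⟩
    obtain ⟨s, rfl⟩ := Nat.exists_eq_add_of_le h1
    exact hconst _ hm s (by omega)

theorem f_cases (t : ℕ) : R.f t = 1 ∨ R.f t = -1 := by
  have h := R.f_eq (Nat.dvd_mul_left (period J) (t / period J)) (Nat.mod_lt t (period_pos J))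
  rw [mul_comm, Nat.div_add_mod] at h
  rw [h, R.f_top _ (Nat.dvd_mul_right _ _)]
  exact inward_cases _ _

/-- Both coordinates tend towards the middle during most of each block of the top level. -/
theorem card_not_inward_le {t : ℕ} (ht : period J ∣ t) :
    100 * ((Finset.Ico t (t + period J)).filter fun r => R.dx r ≠ inward n (R.x t)).card
      ≤ period J ∧
    100 * ((Finset.Ico t (t + period J)).filter fun r => R.dy r ≠ inward n (R.y t)).card
      ≤ period J := by
  classical
  obtain ⟨w, h1, h2, h3⟩ := R.exists_change ht
  have hint := R.card_interference_le le_rfl ht (R.dx_cases t) (R.f_cases t) h1 h2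
    Finset.univ (by
      have := R.card_lt
      rw [Finset.card_univ, Fintype.card_fin, pow_succ]
      omega) (fun _ _ _ _ _ => Finset.subset_univ _)
  constructor
  · refine (Nat.mul_le_mul_left 100 (Finset.card_le_card fun r hr => ?_)).trans hint
    rw [Finset.mem_filter, Finset.mem_Ico] at hr
    refine Finset.mem_filter.2 ⟨Finset.mem_Ico.2 hr.1, h3 r hr.1.1 ?_⟩
    by_contra hw
    exact hr.2 (by rw [h2 r (not_lt.1 hw) hr.1.2, R.f_top t ht])
  · refine (Nat.mul_le_mul_left 100 (Finset.card_le_card fun r hr => ?_)).trans hint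
    rw [Finset.mem_filter, Finset.mem_Ico] at hr
    refine Finset.mem_filter.2 ⟨Finset.mem_Ico.2 hr.1, ?_⟩
    obtain ⟨s, rfl⟩ := Nat.exists_eq_add_of_le hr.1.1
    have he := R.e_eq ht (s := s) (by omega)
    rw [R.e_top t ht] at he
    refine (R.dy_eq_or le_rfl ?_).resolve_left fun h => hr.2 (by rw [h, he])
    rcases R.e_top_cases (t + s) with h | h <;> simp [h]

end Run

/-- A walk with steps `±2` which in each block mostly tends towards the middle stays inside. -/
theorem mem_board {z g : ℕ → ℤ} {n P : ℕ} (hP : 0 < P) (hn : 8 * P + 2 ≤ n)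
    (hz : ∀ t, z (t + 1) = z t + 2 * g t) (hg : ∀ t, g t = 1 ∨ g t = -1)
    (h0 : 2 * P ≤ z 0 ∧ z 0 + 2 * P < n)
    (h : ∀ t, P ∣ t →
      100 * ((Finset.Ico t (t + P)).filter fun r => g r ≠ inward n (z t)).card ≤ P) (t : ℕ) :
    0 ≤ z t ∧ z t < n := by
  -- A margin of `2 * P` at block starts absorbs the motion within a block; `8 * P < n` prevents an
  -- inward block from overshooting into the opposite margin.
  have hq : ∀ q, 2 * P ≤ z (P * q) ∧ z (P * q) + 2 * P < n := by
    intro q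
    induction q with
    | zero => simpa using h0
    | succ q ih =>
      have h1 := displacement hz hg (inward_cases n (z (P * q))) (P * q) P
      have h2 := h _ (Nat.dvd_mul_right P q)
      rw [Nat.mul_succ]
      generalize ((Finset.Ico (P * q) (P * q + P)).filter
        fun r => g r ≠ inward n (z (P * q))).card = m at h1 h2
      unfold inward at h1
      split_ifs at h1 <;> omega
  have h1 := hq (t / P)
  have h2 := (displacement hz hg (.inl rfl) (P * (t / P)) (t % P)).1
  have h3 := (displacement hz hg (d := -1) (.inr rfl) (P * (t / P)) (t % P)).1
  rw [Nat.div_add_mod] at h2 h3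
  have h4 := Nat.mod_lt t hP
  omega

theorem Run.mem_board {k J n : ℕ} (R : Run k J n) (hn : 8 * period J + 2 ≤ n)
    (hx : 2 * period J ≤ R.x 0 ∧ R.x 0 + 2 * period J < n)
    (hy : 2 * period J ≤ R.y 0 ∧ R.y 0 + 2 * period J < n) (t : ℕ) :
    (0 ≤ R.x t ∧ R.x t < n) ∧ 0 ≤ R.y t ∧ R.y t < n :=
  ⟨FastRobber.mem_board (period_pos J) hn R.x_succ R.dx_cases hx
      (fun _ ht => (R.card_not_inward_le ht).1) t,
    FastRobber.mem_board (period_pos J) hn R.y_succ R.dy_cases hy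
      (fun _ ht => (R.card_not_inward_le ht).2) t⟩

/-! ### Construction of the run -/

/-- What the robber keeps in mind: his position, his current horizontal direction, the directions
demanded by the levels, and the default horizontal direction. -/
structure State where
  x : ℤ
  y : ℤ
  dx : ℤ
  e : ℕ → ℤ
  f : ℤ

namespace State

variable {k : ℕ}

/-- At time `t` the robber sees the cops at `u`, `v` and revises his directions. -/
noncomputable def observe (J n t : ℕ) (s : State) (u v : Fin k → ℤ) : State :=
  letI := Classical.propDecidable
  let e : ℕ → ℤ := fun i =>
    if period i ∣ t then if i < J then evasion i s.x s.y u v else inward n s.y else s.e i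
  let f := if period J ∣ t then inward n s.x else s.f
  ⟨s.x, s.y, if ∃ i < J, e i ≠ 0 then s.dx else f, e, f⟩

/-- The vertical direction demanded by the lowest active level. -/
noncomputable def dy (J : ℕ) (s : State) : ℤ :=
  letI := Classical.propDecidable
  -- The default 1 is never used in a run, where level `J` always demands a direction.
  if h : ∃ i, i ≤ J ∧ s.e i ≠ 0 then s.e (Nat.find h) else 1

noncomputable def move (J : ℕ) (s : State) : State :=
  ⟨s.x + 2 * s.dx, s.y + 2 * s.dy J, s.dx, s.e, s.f⟩

theorem dy_eq {J i : ℕ} {s : State} (hi : i ≤ J) (h : s.e i ≠ 0) (h' : ∀ j < i, s.e j = 0) :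
    s.dy J = s.e i := by
  classical
  have hex : ∃ i, i ≤ J ∧ s.e i ≠ 0 := ⟨i, hi, h⟩
  unfold dy
  rw [dif_pos hex]
  refine congrArg s.e ((@Nat.find_eq_iff _ _ (_) _).2 ?_)
  exact ⟨⟨hi, h⟩, fun j hj h2 => h2.2 (h' j hj)⟩

end State

variable {k : ℕ}

/-- A starting position far from all cops and from the boundary. -/
noncomputable def haven (J n : ℕ) (u v : Fin k → ℤ) : ℤ × ℤ :=
  Classical.epsilon fun p : ℤ × ℤ => near p.1 p.2 u v (8 * reach J) = ∅ ∧
    (2 * period J ≤ p.1 ∧ p.1 + 2 * period J < n) ∧ 2 * period J ≤ p.2 ∧ p.2 + 2 * period J < n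

theorem haven_spec {J n : ℕ} (hn : reach J * (130 + 17 * k) ≤ n) (u v : Fin k → ℤ) :
    near (haven J n u v).1 (haven J n u v).2 u v (8 * reach J) = ∅ ∧
    (2 * period J ≤ (haven J n u v).1 ∧ (haven J n u v).1 + 2 * period J < n) ∧
    2 * period J ≤ (haven J n u v).2 ∧ (haven J n u v).2 + 2 * period J < n := by
  apply Classical.epsilon_spec (p := fun p : ℤ × ℤ => near p.1 p.2 u v (8 * reach J) = ∅ ∧
    (2 * period J ≤ p.1 ∧ p.1 + 2 * period J < n) ∧ 2 * period J ≤ p.2 ∧ p.2 + 2 * period J < n)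
  have hr := reach_pos J
  have hP : period J = 16 * reach J := rfl
  generalize reach J = r at *
  by_contra hne
  -- Pigeonhole: among `k + 1` columns spaced `17 * r` apart, a cop can be within `8 * r` of only
  -- one.
  have hbad : ∀ l : Fin (k + 1), ∃ c : Fin k,
      |u c - (2 * period J + 17 * r * (l : ℕ) : ℕ)| ≤ 8 * r := by
    intro l
    by_contra hl
    push Not at hl
    refine hne ⟨((2 * period J + 17 * r * (l : ℕ) : ℕ), (2 * period J : ℕ)), ?_, ⟨?_, ?_⟩, ?_, ?_⟩
    · refine Finset.eq_empty_of_forall_notMem fun c hc => ?_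
      have h1 := (Finset.mem_filter.1 hc).2.1
      have h2 := hl c
      push_cast at h1 h2
      omega
    · have := Nat.zero_le (17 * r * l)
      omega
    · have h1 : 17 * r * (l : ℕ) ≤ 17 * r * k := Nat.mul_le_mul_left _ (Nat.le_of_lt_succ l.2)
      have h2 : r * (130 + 17 * k) = 130 * r + 17 * r * k := by ring
      omega
    · omega
    · have h2 : r * (130 + 17 * k) = 130 * r + 17 * r * k := by ring
      omega
  choose g hg using hbad
  obtain ⟨l, l', hll, hgl⟩ := Fintype.exists_ne_map_eq_of_card_lt g (by simp)
  have h1 := abs_le.1 (hg l)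
  have h2 := abs_le.1 (hg l')
  rw [hgl] at h1
  have key : ∀ a b : ℕ, a < b → 17 * r * b ≤ 17 * r * a + 16 * r → False := by
    intro a b hab h
    have : 17 * r * (a + 1) ≤ 17 * r * b := Nat.mul_le_mul_left _ hab
    rw [mul_add] at this
    omega
  rcases lt_or_gt_of_ne (Fin.val_ne_of_ne hll) with h | h
  · exact key _ _ h (by omega)
  · exact key _ _ h (by omega)

/-- The state of the robber at time `t`, before he has seen the cops at that time. -/
noncomputable def stateAt (J n : ℕ) (u v : ℕ → Fin k → ℤ) : ℕ → State
  | 0 => ⟨(haven J n (u 0) (v 0)).1, (haven J n (u 0) (v 0)).2, 1, fun _ => 1, 1⟩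
  | t + 1 => ((stateAt J n u v t).observe J n t (u t) (v t)).move J

/-- The robber does not look ahead, so his run can be recomputed from the finite history. -/
theorem stateAt_congr {J n : ℕ} {u v u' v' : ℕ → Fin k → ℤ} {t : ℕ}
    (hu : ∀ r ≤ t, u r = u' r) (hv : ∀ r ≤ t, v r = v' r) :
    stateAt J n u v t = stateAt J n u' v' t := by
  induction t with
  | zero => simp only [stateAt, hu 0 le_rfl, hv 0 le_rfl]
  | succ t ih =>
    simp only [stateAt]
    rw [ih (fun r hr => hu r (by omega)) (fun r hr => hv r (by omega)), hu t (by omega),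
      hv t (by omega)]

theorem stateAt_directions (J n : ℕ) (u v : ℕ → Fin k → ℤ) (t : ℕ) :
    ((stateAt J n u v t).dx = 1 ∨ (stateAt J n u v t).dx = -1) ∧
    ((stateAt J n u v t).f = 1 ∨ (stateAt J n u v t).f = -1) := by
  induction t with
  | zero => simp [stateAt]
  | succ t ih =>
    have h := inward_cases n (stateAt J n u v t).x
    simp only [stateAt, State.move, State.observe]
    split_ifs
    exacts [⟨ih.1, h⟩, ⟨ih.1, ih.2⟩, ⟨h, h⟩, ⟨ih.2, ih.2⟩]

/-- The run of the robber against cops with coordinates `u`, `v`. -/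
noncomputable def run {J : ℕ} (n : ℕ) (hk : k < 2 ^ J) (u v : ℕ → Fin k → ℤ)
    (hu : ∀ t c, |u (t + 1) c - u t c| ≤ 1) (hv : ∀ t c, |v (t + 1) c - v t c| ≤ 1) :
    Run k J n where
  u := u
  v := v
  x t := (stateAt J n u v t).x
  y t := (stateAt J n u v t).y
  -- Directions chosen at time `t` are stored in the state at `t + 1`, since `stateAt` precedes the
  -- observation.
  dx t := (stateAt J n u v (t + 1)).dx
  dy t := ((stateAt J n u v t).observe J n t (u t) (v t)).dy J
  e t := (stateAt J n u v (t + 1)).e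
  f t := (stateAt J n u v (t + 1)).f
  card_lt := hk
  abs_u := hu
  abs_v := hv
  x_succ _ := rfl
  y_succ _ := rfl
  dx_cases t := (stateAt_directions J n u v (t + 1)).1
  e_start t i hi ht := by simp [stateAt, State.move, State.observe, hi, ht]
  e_top t ht := by simp [stateAt, State.move, State.observe, ht]
  f_top t ht := by simp [stateAt, State.move, State.observe, ht]
  e_succ t i ht := by
    rw [stateAt]
    simp only [State.move, State.observe, if_neg ht]
  f_succ t ht := by
    rw [stateAt]
    simp only [State.move, State.observe, if_neg ht]
  dy_eq t i hi h h' := State.dy_eq hi h h'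
  dx_succ t i hi h := by
    rw [stateAt] at h ⊢
    simp only [State.move, State.observe] at h ⊢
    rw [if_pos ⟨i, hi, h⟩]
  dx_eq t h := by
    rw [stateAt] at h ⊢
    simp only [State.move, State.observe] at h ⊢
    rw [if_neg]
    push Not
    exact h

/-! ### Transfer to the game -/

/-- The vertex of the grid with integer coordinates `x`, `y`. -/
def vertex (n : ℕ) [NeZero n] (x y : ℤ) : Fin n × Fin n :=
  (Fin.ofNat n x.toNat, Fin.ofNat n y.toNat)

theorem vertex_coord {n : ℕ} [NeZero n] {x y : ℤ} (hx : 0 ≤ x ∧ x < n) (hy : 0 ≤ y ∧ y < n) :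
    (((vertex n x y).1 : ℕ) : ℤ) = x ∧ (((vertex n x y).2 : ℕ) : ℤ) = y := by
  simp only [vertex, Fin.val_ofNat]
  rw [Nat.mod_eq_of_lt (by omega), Nat.mod_eq_of_lt (by omega)]
  omega

theorem vertex_adj {n : ℕ} [NeZero n] {x y d d' : ℤ} (hd : d = 1 ∨ d = -1)
    (hd' : d' = 1 ∨ d' = -1) (hx : 0 ≤ x ∧ x < n) (hy : 0 ≤ y ∧ y < n)
    (hx' : 0 ≤ x + d ∧ x + d < n) (hy' : 0 ≤ y + d' ∧ y + d' < n) :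
    (kingGrid n).Adj (vertex n x y) (vertex n (x + d) (y + d')) := by
  have h1 := vertex_coord hx hy
  have h2 := vertex_coord hx' hy'
  refine ⟨fun h => ?_, ?_, ?_⟩
  · rw [← h] at h2
    omega
  · rw [h1.1, h2.1, abs_le]
    omega
  · rw [h1.2, h2.2, abs_le]
    omega

/-- The robber's strategy: he recomputes his whole run from the list of cop configurations. -/
noncomputable def runStrategy (k J n : ℕ) [NeZero n] : RobberStrategy (Fin n × Fin n) k := fun l =>
  -- The default 0 past the end of the list has no influence on the state at the last time.
  let s := stateAt J n (fun t i => (l[t]?).elim 0 fun c => (((c i).1 : ℕ) : ℤ))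
    (fun t i => (l[t]?).elim 0 fun c => (((c i).2 : ℕ) : ℤ)) (l.length - 1)
  vertex n s.x s.y

theorem runStrategy_position (J n : ℕ) [NeZero n] (c : ℕ → Fin k → Fin n × Fin n) (t : ℕ) :
    (runStrategy k J n).position c t =
      vertex n (stateAt J n (fun t i => (((c t i).1 : ℕ) : ℤ)) (fun t i => (((c t i).2 : ℕ) : ℤ)) t).x
        (stateAt J n (fun t i => (((c t i).1 : ℕ) : ℤ)) (fun t i => (((c t i).2 : ℕ) : ℤ)) t).y := by
  have h : ∀ r ≤ t, ((List.range (t + 1)).map c)[r]? = some (c r) := by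
    intro r hr
    simp [List.getElem?_range (show r < t + 1 by omega)]
  simp only [RobberStrategy.position, runStrategy, List.length_map, List.length_range,
    Nat.add_sub_cancel]
  rw [stateAt_congr (u' := fun t i => (((c t i).1 : ℕ) : ℤ))
    (v' := fun t i => (((c t i).2 : ℕ) : ℤ))] <;>
  · intro r hr
    simp [h r hr]

/-- On a large enough grid the robber evades fewer than `2 ^ J` cops. -/
theorem robberEvades_of_le {J n : ℕ} (hk : k < 2 ^ J) (hn : reach J * (130 + 17 * k) ≤ n) :
    RobberEvades (kingGrid n) 2 k := by
  have hr := four_le_reach J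
  have hn' : 130 * reach J ≤ n := le_trans (by rw [mul_comm]; gcongr; omega) hn
  have : NeZero n := ⟨by omega⟩
  refine ⟨runStrategy k J n, fun c hc => ?_⟩
  have hstep : ∀ t i, |(((c (t + 1) i).1 : ℕ) : ℤ) - (((c t i).1 : ℕ) : ℤ)| ≤ 1 ∧
      |(((c (t + 1) i).2 : ℕ) : ℤ) - (((c t i).2 : ℕ) : ℤ)| ≤ 1 := by
    intro t i
    rcases hc t i with h | h
    · simp [h]
    · rw [abs_sub_comm, abs_sub_comm (((c (t + 1) i).2 : ℕ) : ℤ)]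
      exact h.2
  let R := run n hk (fun t i => (((c t i).1 : ℕ) : ℤ)) (fun t i => (((c t i).2 : ℕ) : ℤ))
    (fun t i => (hstep t i).1) (fun t i => (hstep t i).2)
  have hpos : ∀ t, (runStrategy k J n).position c t = vertex n (R.x t) (R.y t) :=
    runStrategy_position J n c
  obtain ⟨h0, hx, hy⟩ := haven_spec hn (R.u 0) (R.v 0)
  have hboard := R.mem_board (by unfold period; omega) hx hy
  have hempty := R.close_four_eq_empty h0
  have hfar : ∀ t, ∀ w w' : ℤ, (0 ≤ w ∧ w < n) → (0 ≤ w' ∧ w' < n) → |w - R.x t| ≤ 2 →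
      |w' - R.y t| ≤ 2 → ¬ Occupied (c t) (vertex n w w') ∧
        ¬ Occupied (c (t + 1)) (vertex n w w') := by
    intro t w w' hw hw' h1 h2
    have hv := vertex_coord hw hw'
    rw [abs_le] at h1 h2
    -- The robber's path stays within 2 of its start and the cops move by 1, so an empty square of
    -- radius 4 suffices.
    have key : ∀ i, |R.u t i - w| ≤ 1 → |R.v t i - w'| ≤ 1 → False := by
      intro i h3 h4
      have : i ∈ R.close t 4 := by
        rw [R.mem_close]
        simp only [abs_le] at *
        push_cast
        omega
      simp [hempty t] at this
    constructor
    · rintro ⟨i, hi⟩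
      refine key i ?_ ?_
      · change |(((c t i).1 : ℕ) : ℤ) - w| ≤ 1
        simp [hi, hv.1]
      · change |(((c t i).2 : ℕ) : ℤ) - w'| ≤ 1
        simp [hi, hv.2]
    · rintro ⟨i, hi⟩
      have h3 := hstep t i
      rw [hi, hv.1, hv.2, abs_sub_comm, abs_sub_comm w'] at h3
      exact key i h3.1 h3.2
  refine ⟨?_, fun t => ⟨?_, ?_⟩⟩
  · rw [hpos]
    exact (hfar 0 _ _ (hboard 0).1 (hboard 0).2 (by simp) (by simp)).1
  · rw [hpos]
    exact (hfar t _ _ (hboard t).1 (hboard t).2 (by simp) (by simp)).2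
  · rw [hpos, hpos]
    have b0 := hboard t
    have b1 := hboard (t + 1)
    have hdx := R.dx_cases t
    have hdy := R.dy_cases t
    have ex : R.x (t + 1) = R.x t + R.dx t + R.dx t := by rw [R.x_succ]; ring
    have ey : R.y (t + 1) = R.y t + R.dy t + R.dy t := by rw [R.y_succ]; ring
    rw [ex, ey] at b1 ⊢
    have bx : 0 ≤ R.x t + R.dx t ∧ R.x t + R.dx t < n := by omega
    have bby : 0 ≤ R.y t + R.dy t ∧ R.y t + R.dy t < n := by omega
    refine ⟨.cons (vertex_adj hdx hdy b0.1 b0.2 bx bby)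
      (.cons (vertex_adj hdx hdy bx bby b1.1 b1.2) .nil), by simp, ?_⟩
    intro w hw
    simp only [SimpleGraph.Walk.support_cons, SimpleGraph.Walk.support_nil, List.mem_cons,
      List.not_mem_nil, or_false] at hw
    rcases hw with rfl | rfl | rfl
    · exact (hfar t _ _ b0.1 b0.2 (by simp) (by simp)).2
    · refine (hfar t _ _ bx bby ?_ ?_).2 <;> rw [abs_le] <;> omega
    · refine (hfar t _ _ b1.1 b1.2 ?_ ?_).2 <;> rw [abs_le] <;> omega

/-- As 65536 is `2 ^ 16`, `reach J` costs `k ^ 16`, and the search for a start one more factor `k`.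
The other 16 powers of `k` absorb constants once `k ≥ 4`; `2 ^ 60` handles smaller `k`. -/
theorem exists_level {k n : ℕ} (hn : 2 ^ 60 ≤ n) (h : k ^ 33 ≤ n) :
    ∃ J, k < 2 ^ J ∧ reach J * (130 + 17 * k) ≤ n := by
  rcases Nat.eq_zero_or_pos k with rfl | hk
  · exact ⟨0, by norm_num, by norm_num [reach]; omega⟩
  refine ⟨Nat.log 2 k + 1, Nat.lt_pow_succ_log_self (by norm_num) k, ?_⟩
  have h1 : 2 ^ Nat.log 2 k ≤ k := Nat.pow_log_le_self 2 hk.ne'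
  have h2 : reach (Nat.log 2 k + 1) ≤ 2 ^ 18 * k ^ 16 := by
    have : reach (Nat.log 2 k + 1) = 2 ^ 18 * (2 ^ Nat.log 2 k) ^ 16 := by
      rw [reach, show 65536 = 2 ^ 16 by norm_num, ← pow_mul, ← pow_mul, show 4 = 2 ^ 2 by norm_num,
        ← pow_add, ← pow_add]
      congr 1
      ring
    rw [this]
    gcongr
  calc reach (Nat.log 2 k + 1) * (130 + 17 * k)
      ≤ (2 ^ 18 * k ^ 16) * (2 ^ 8 * k) := Nat.mul_le_mul h2 (by omega)
    _ = 2 ^ 26 * k ^ 17 := by ring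
    _ ≤ n := by
      rcases le_or_gt k 3 with h3 | h3
      · calc 2 ^ 26 * k ^ 17 ≤ 2 ^ 26 * 3 ^ 17 := by gcongr
          _ ≤ 2 ^ 60 := by norm_num
          _ ≤ n := hn
      · calc 2 ^ 26 * k ^ 17 ≤ 4 ^ 16 * k ^ 17 := Nat.mul_le_mul_right _ (by norm_num)
          _ ≤ k ^ 16 * k ^ 17 := by gcongr; omega
          _ = k ^ 33 := by ring
          _ ≤ n := h

end FastRobber

theorem corollary4p2 :
    ∃ N : ℕ, ∀ n : ℕ, N ≤ n → ∀ k : ℕ, (k : ℝ) ≤ (n : ℝ) ^ (0.03 : ℝ) →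
      FastRobber.RobberEvades (kingGrid n) 2 k := by
  refine ⟨2 ^ 60, fun n hn k hk => ?_⟩
  have hn1 : (1 : ℝ) ≤ n := by exact_mod_cast (show 1 ≤ 2 ^ 60 by norm_num).trans hn
  have h : (k : ℝ) ^ 33 ≤ n := by
    calc (k : ℝ) ^ 33 ≤ ((n : ℝ) ^ (0.03 : ℝ)) ^ 33 := by gcongr
      _ = (n : ℝ) ^ (0.99 : ℝ) := by
        rw [← Real.rpow_natCast, ← Real.rpow_mul (by positivity)]
        norm_num
      _ ≤ (n : ℝ) ^ (1 : ℝ) := Real.rpow_le_rpow_of_exponent_le hn1 (by norm_num)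
      _ = n := Real.rpow_one _
  obtain ⟨J, hJ, hle⟩ := FastRobber.exists_level hn (by exact_mod_cast h)
  exact FastRobber.robberEvades_of_le hJ hle
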